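/- Let $m\ge 0$, $I=\{1,\dots,m\}$, and for a finite set $\alpha$ let $S^{\alpha}=\{x\in\mathbb R^{\alpha}: x_k\ge 0,\ \sum_{k\in\alpha} x_k=1\}$. A Volterra quadratic stochastic operator on $S^{\alpha}$ is a map $V:S^{\alpha}\to S^{\alpha}$ of the form $$(Vx)_k=x_k\Bigl(1+\sum_{i\in\alpha}a_{ki}x_i\Bigr),\qquad k\in\alpha,$$ where $A=(a_{ki})$ is a real skew-symmetric matrix with $|a_{ki}|\le 1$ (the matrix $A$ is determined by $V$). It is called transversal if all principal minors of $A$ of even order are nonzero. Let $\mathcal V_t(\alpha)$ be the set of transversal Volterra operators on $S^{\alpha}$, with the topology of uniform convergence (equivalently, of convergence of the entries of $A$). Two operators $V_0,V_1\in\mathcal V_t(\alpha)$ are homotopic, $V_0\sim V_1$, if there is a continuous path $(V_\lambda)_{\lambda\in[0,1]}$ in $\mathcal V_t(\alpha)$ from $V_0$ to $V_1$ such that $|\mathrm{Fix}(V_\lambda)|=|\mathrm{Fix}(V_0)|=|\mathrm{Fix}(V_1)|$ for all $\lambda\in[0,1]$, where $\mathrm{Fix}(V)$ is the set of fixed points of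 $V$. This is an equivalence relation. For $\alpha\subset I$ identify $S^{\alpha}$ with the face $\Gamma_\alpha$ of the simplex $S^{I}$ spanned by the vertices $e_i$, $i\in\alpha$ (extend coordinates by zero). Every $V\in\mathcal V_t(I)$ maps $\Gamma_\alpha$ into itself and $V|_{\Gamma_\alpha}\in\mathcal V_t(\alpha)$. For a transversal Volterra operator $V_0$ on the face $\Gamma_\alpha$ (for instance the restriction to $\Gamma_\alpha$ of an operator in $\mathcal V_t(I)$) put $$F_{V_0}(\alpha)=\{V\in\mathcal V_t(I): V|_{\Gamma_\alpha}\sim V_0\}.$$ **Theorem.** The set $\mathcal V_t(I)/{\sim}=\{\mathcal V_1,\dots,\mathcal V_r\}$ of homotopy classes is finite. For every $\alpha\subset I$, every transversal Volterra operator $V_0$ on $\Gamma_\alpha$ and every $i\in\{1,\dots,r\}$: if $F_{V_0}(\alpha)\cap\mathcal V_i$ is not empty, then it is path-connected. Consequently $$F_{V_0}(\alpha)=\bigcup_{i=1}^r\bigl(F_{V_0}(\alpha)\cap\mathcal V_i\bigr),$$ the path components of $F_{V_0}(\alpha)$ are exactly the nonempty sets among $F_{V_0}(\alpha)\cap\mathcal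 V_i$, and there are at most $r$ of them. -/

import Mathlib

/-- Matrices `A` with real entries, `a_{ki} = -a_{ik}` and `|a_{ki}| ≤ 1`. -/
def IsVolterraMatrix {ι : Type*} (A : Matrix ι ι ℝ) : Prop :=
  (∀ k i, A k i = -A i k) ∧ ∀ k i, |A k i| ≤ 1

/-- A matrix is transversal if all its principal minors of even order are nonzero. -/
def IsTransversalMatrix {ι : Type*} [DecidableEq ι] (A : Matrix ι ι ℝ) : Prop :=
  ∀ β : Finset ι, Even β.card →
    (A.submatrix (fun i : β => (i : ι)) (fun i : β => (i : ι))).det ≠ 0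

/-- `V : S → S` is the Volterra quadratic stochastic operator of the matrix `A`:
`(V x)_k = x_k (1 + ∑ i, a_{ki} x_i)`. -/
def IsVolterraOpOf {ι : Type*} [Fintype ι] (A : Matrix ι ι ℝ)
    (V : stdSimplex ℝ ι → stdSimplex ℝ ι) : Prop :=
  IsVolterraMatrix A ∧
    ∀ (x : stdSimplex ℝ ι) (k : ι), V x k = x k * (1 + ∑ i, A k i * x i)

/-- The transversal Volterra operators of the simplex with vertices indexed by `ι`, a subset of
the space of continuous self-maps of the simplex with the topology of uniform convergence.
(The matrix of a Volterra operator is determined by the operator.) -/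
def transversalVolterraOps (ι : Type*) [Fintype ι] [DecidableEq ι] :
    Set C(stdSimplex ℝ ι, stdSimplex ℝ ι) :=
  {V | ∃ A : Matrix ι ι ℝ, IsVolterraOpOf A V ∧ IsTransversalMatrix A}

/-- The space of transversal Volterra operators, with the topology of uniform convergence. -/
abbrev TVOp (ι : Type*) [Fintype ι] [DecidableEq ι] : Type _ :=
  ↥(transversalVolterraOps ι)

/-- The number of fixed points (possibly infinite, a priori) of a transversal Volterra operator. -/
noncomputable def TVOp.fixCard {ι : Type*} [Fintype ι] [DecidableEq ι] (V : TVOp ι) : ℕ∞ :=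
  {x : stdSimplex ℝ ι | V.1 x = x}.encard

/-- Homotopy of transversal Volterra operators: a continuous path of transversal Volterra operators
all of which have the same number of fixed points. -/
def TVOp.Homotopic {ι : Type*} [Fintype ι] [DecidableEq ι] (V₀ V₁ : TVOp ι) : Prop :=
  ∃ γ : Path V₀ V₁, ∀ t, (γ t).fixCard = V₀.fixCard ∧ (γ t).fixCard = V₁.fixCard

theorem TVOp.homotopic_iff_joinedIn {ι : Type*} [Fintype ι] [DecidableEq ι] {V₀ V₁ : TVOp ι} :
    V₀.Homotopic V₁ ↔ JoinedIn {V : TVOp ι | V.fixCard = V₀.fixCard} V₀ V₁ := by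
  constructor
  · rintro ⟨γ, h⟩
    exact ⟨γ, fun t => (h t).1⟩
  · rintro ⟨γ, h⟩
    refine ⟨γ, fun t => ⟨h t, (h t).trans ?_⟩⟩
    have h1 := h 1
    rw [γ.target] at h1
    exact h1.symm

theorem TVOp.Homotopic.fixCard_eq {ι : Type*} [Fintype ι] [DecidableEq ι] {V₀ V₁ : TVOp ι}
    (h : V₀.Homotopic V₁) : V₁.fixCard = V₀.fixCard := by
  obtain ⟨γ, h⟩ := h
  exact (h 0).2.symm.trans (h 0).1

/-- Homotopy is an equivalence relation on the space of transversal Volterra operators. -/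
def TVOp.homotopySetoid (ι : Type*) [Fintype ι] [DecidableEq ι] : Setoid (TVOp ι) where
  r := TVOp.Homotopic
  iseqv :=
    { refl := fun V => TVOp.homotopic_iff_joinedIn.2 (JoinedIn.refl rfl)
      symm := fun {V W} h => by
        have e := h.fixCard_eq
        rw [TVOp.homotopic_iff_joinedIn] at h ⊢
        rw [e]
        exact h.symm
      trans := fun {V W U} h h' => by
        have e := h.fixCard_eq
        rw [TVOp.homotopic_iff_joinedIn] at h h' ⊢
        rw [e] at h'
        exact h.trans h' }

/-- The homotopy classes `𝒱₁, …, 𝒱_r`. -/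
def TVOp.homotopyClasses (ι : Type*) [Fintype ι] [DecidableEq ι] : Set (Set (TVOp ι)) :=
  (TVOp.homotopySetoid ι).classes

/-- The simplex with vertices indexed by `α` as the face `Γ_α` of the simplex with vertices indexed
by `ι`: extension of the barycentric coordinates by zero. -/
def faceIncl {ι : Type*} [Fintype ι] [DecidableEq ι] (α : Finset ι) (y : stdSimplex ℝ α) :
    stdSimplex ℝ ι :=
  ⟨fun k => if h : k ∈ α then y ⟨k, h⟩ else 0,
    fun k => by
      by_cases h : k ∈ α
      · simp only [h, dif_pos]
        exact stdSimplex.zero_le y _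
      · simp [h],
    by
      rw [← Finset.sum_subset (Finset.subset_univ α) (fun k _ hk => by simp [hk]),
        ← Finset.sum_coe_sort, ← stdSimplex.sum_eq_one y]
      exact Finset.sum_congr rfl fun k _ => by simp⟩

theorem faceIncl_apply_mem {ι : Type*} [Fintype ι] [DecidableEq ι] (α : Finset ι)
    (y : stdSimplex ℝ α) (k : α) : faceIncl α y (k : ι) = y k := by
  change (if h : (k : ι) ∈ α then y ⟨k, h⟩ else 0) = y k
  simp

theorem faceIncl_apply_notMem {ι : Type*} [Fintype ι] [DecidableEq ι] (α : Finset ι)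
    (y : stdSimplex ℝ α) {k : ι} (hk : k ∉ α) : faceIncl α y k = 0 := by
  change (if h : k ∈ α then y ⟨k, h⟩ else 0) = 0
  simp [hk]

theorem continuous_faceIncl {ι : Type*} [Fintype ι] [DecidableEq ι] (α : Finset ι) :
    Continuous (faceIncl α) := by
  refine Continuous.subtype_mk (continuous_pi fun k => ?_) _
  by_cases h : k ∈ α
  · simp only [h, dif_pos]
    exact (continuous_apply (⟨k, h⟩ : α)).comp continuous_subtype_val
  · simpa [h] using continuous_const

/-- A Volterra operator maps the face `Γ_α` into itself. -/
theorem TVOp.map_faceIncl_notMem {ι : Type*} [Fintype ι] [DecidableEq ι] (V : TVOp ι)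
    (α : Finset ι) (y : stdSimplex ℝ α) {k : ι} (hk : k ∉ α) : V.1 (faceIncl α y) k = 0 := by
  obtain ⟨A, hA, -⟩ := V.2
  rw [hA.2, faceIncl_apply_notMem α y hk, zero_mul]

theorem TVOp.restrict_mem_stdSimplex {ι : Type*} [Fintype ι] [DecidableEq ι] (V : TVOp ι)
    (α : Finset ι) (y : stdSimplex ℝ α) :
    (fun k : α => V.1 (faceIncl α y) (k : ι)) ∈ stdSimplex ℝ α := by
  refine ⟨fun k => stdSimplex.zero_le _ _, ?_⟩
  rw [← stdSimplex.sum_eq_one (V.1 (faceIncl α y)),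
    ← Finset.sum_subset (Finset.subset_univ α)
      (fun k _ hk => V.map_faceIncl_notMem α y hk)]
  exact Finset.sum_coe_sort α (fun k => V.1 (faceIncl α y) k)

/-- The restriction `V|_{Γ_α} : Γ_α → Γ_α`, with `Γ_α` written as the simplex with vertices indexed
by `α`, as a continuous map. -/
def TVOp.restrictMap {ι : Type*} [Fintype ι] [DecidableEq ι] (V : TVOp ι) (α : Finset ι) :
    C(stdSimplex ℝ α, stdSimplex ℝ α) where
  toFun y := ⟨fun k => V.1 (faceIncl α y) (k : ι), V.restrict_mem_stdSimplex α y⟩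
  continuous_toFun := by
    refine Continuous.subtype_mk (continuous_pi fun k => ?_) _
    exact (continuous_apply (k : ι)).comp (continuous_subtype_val.comp
      (V.1.continuous.comp (continuous_faceIncl α)))

theorem IsTransversalMatrix.restrict {ι : Type*} [DecidableEq ι] {A : Matrix ι ι ℝ}
    (hA : IsTransversalMatrix A) (α : Finset ι) :
    IsTransversalMatrix (A.submatrix (fun i : α => (i : ι)) (fun i : α => (i : ι))) := by
  intro β hβ
  have h := hA (β.map (Function.Embedding.subtype _)) (by rwa [Finset.card_map])
  let f : β → (β.map (Function.Embedding.subtype (fun x => x ∈ α)) : Finset ι) :=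
    fun i => ⟨((i : α) : ι), Finset.mem_map.2 ⟨i, i.2, rfl⟩⟩
  have hf : Function.Bijective f := by
    constructor
    · intro i j hij
      have h' : (f i : ι) = f j := by rw [hij]
      exact Subtype.ext (Subtype.ext h')
    · rintro ⟨k, hk⟩
      obtain ⟨i, hi, rfl⟩ := Finset.mem_map.1 hk
      exact ⟨⟨i, hi⟩, rfl⟩
  let e := Equiv.ofBijective f hf
  rw [← Matrix.det_submatrix_equiv_self e] at h
  exact h

/-- The restriction of a transversal Volterra operator to a face is one. -/
theorem TVOp.restrictMap_mem {ι : Type*} [Fintype ι] [DecidableEq ι] (V : TVOp ι) (α : Finset ι) :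
    V.restrictMap α ∈ transversalVolterraOps α := by
  obtain ⟨A, ⟨⟨hskew, hbd⟩, hV⟩, hT⟩ := V.2
  refine ⟨A.submatrix (fun i : α => (i : ι)) (fun i : α => (i : ι)),
    ⟨⟨fun k i => hskew k i, fun k i => hbd k i⟩, fun y k => ?_⟩, hT.restrict α⟩
  change V.1 (faceIncl α y) (k : ι) = _
  rw [hV, faceIncl_apply_mem, ← Finset.sum_subset (Finset.subset_univ α)
    (fun i _ hi => by rw [faceIncl_apply_notMem α y hi, mul_zero]), ← Finset.sum_coe_sort]
  simp only [faceIncl_apply_mem, Matrix.submatrix_apply]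

/-- The restriction `V|_{Γ_α}` of a transversal Volterra operator to the face `Γ_α`. -/
def TVOp.restrict {ι : Type*} [Fintype ι] [DecidableEq ι] (V : TVOp ι) (α : Finset ι) : TVOp α :=
  ⟨V.restrictMap α, V.restrictMap_mem α⟩

/-- `F_{V₀}(α)`: the transversal Volterra operators of the whole simplex whose restriction to the
face `Γ_α` is homotopic to the transversal Volterra operator `V₀` of that face. -/
def homotopicExtensions {ι : Type*} [Fintype ι] [DecidableEq ι] (α : Finset ι) (V₀ : TVOp α) :
    Set (TVOp ι) :=
  {V | (V.restrict α).Homotopic V₀}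

/-- The set of path components of a subset `F` of a topological space. -/
def pathComponentsOf {X : Type*} [TopologicalSpace X] (F : Set X) : Set (Set X) :=
  {C | ∃ x ∈ F, C = pathComponentIn F x}

/-! Homotopy is nothing but joinability by a path in the space of transversal operators. The support
of a fixed point has odd order, since an even principal submatrix has trivial kernel. On an odd set
`β`, the principal skew-symmetric matrix has a one-dimensional kernel spanned by any column of its
adjugate, and no entry of that adjugate is zero. So `β` carries a fixed point, then a unique one,
exactly when the entries in each column of the adjugate have equal signs. Along a path of
transversal operators these signs cannot change, so the number of fixed points is constant
(`TVOp.fixCard_eq_of_joined`), and the homotopy classes are the path components.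

Restriction to a face is continuous, so a path in the whole space restricts to a homotopy on the
face. Hence the set of homotopic extensions is a union of path components, and each nonempty
intersection with a class is the whole class.

Finiteness remains. The space is a continuous image of the complement of the hypersurface where a
product of even minors vanishes. Such complements have finitely many path components
(`MvPolynomial.hasFinitelyManyPathComponents`), by induction on the number of variables: off a
hypersurface `D = 0` in the remaining variables, the zeros in one variable are simple and locally
bounded. Points between them can then be carried along paths in the base to finitely many fibres,
each a line without finitely many points. -/

/-! ### Removing multiple zeros of a polynomial -/

open Polynomial in
/-- Denominators of a polynomial over a fraction field can be cleared. -/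
theorem exists_map_eq_C_mul {R K : Type*} [CommRing R] [IsDomain R] [Field K] [Algebra R K]
    [IsFractionRing R K] (p : K[X]) :
    ∃ d : R, d ≠ 0 ∧ ∃ P : R[X], P.map (algebraMap R K) = C (algebraMap R K d) * p := by
  obtain ⟨b, hb, h⟩ := IsLocalization.integerNormalization_spec (nonZeroDivisors R) p
  refine ⟨b, nonZeroDivisors.ne_zero hb, _, h.trans ?_⟩
  rw [← Polynomial.smul_eq_C_mul, algebraMap_smul]

open Polynomial in
/-- Up to a nonzero constant `D`, every nonzero polynomial over a domain of characteristic zero has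
the same zeros as a polynomial without multiple zeros. -/
theorem exists_separable_model {R : Type*} [CommRing R] [IsDomain R] [CharZero R] {f : R[X]}
    (hf : f ≠ 0) :
    ∃ (D : R) (g : R[X]), D ≠ 0 ∧ (∃ a b : R[X], a * g + b * derivative g = C D) ∧
      (∃ (n : ℕ) (u : R[X]), C D * g ^ n = f * u) ∧ (∃ v : R[X], C D * f = g * v) ∧
      g.leadingCoeff ∣ D := by
  classical
  let K := FractionRing R
  have hinj : Function.Injective (algebraMap R K) := IsFractionRing.injective R K
  have hminj : Function.Injective (Polynomial.map (algebraMap R K)) := map_injective _ hinj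
  have : CharZero K := charZero_of_injective_algebraMap hinj
  set F : K[X] := f.map (algebraMap R K) with hF
  have hF0 : F ≠ 0 := (Polynomial.map_ne_zero_iff hinj).2 hf
  -- The radical has the zeros of `F` and is squarefree, hence separable in characteristic zero. A
  -- multiple of it with coefficients in `R` serves as `g`.
  set r : K[X] := UniqueFactorizationMonoid.radical F with hr
  have hr0 : r ≠ 0 := UniqueFactorizationMonoid.radical_ne_zero
  obtain ⟨n, q, hq⟩ := UniqueFactorizationMonoid.exists_dvd_radical_self_pow hF0
  obtain ⟨w, hw⟩ : r ∣ F := UniqueFactorizationMonoid.radical_dvd_self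
  obtain ⟨c, hc, g, hg⟩ := exists_map_eq_C_mul (R := R) r
  have hc' : algebraMap R K c ≠ 0 := (map_ne_zero_iff _ hinj).2 hc
  have hg0 : g ≠ 0 := by
    rintro rfl
    rw [Polynomial.map_zero] at hg
    exact mul_ne_zero (C_ne_zero.2 hc') hr0 hg.symm
  have hsep : (g.map (algebraMap R K)).Separable := by
    rw [hg]
    exact (PerfectField.separable_iff_squarefree.2
      UniqueFactorizationMonoid.squarefree_radical).unit_mul (isUnit_C.2 hc'.isUnit)
  obtain ⟨a, b, hab⟩ := hsep
  obtain ⟨d₁, hd₁, a', ha'⟩ := exists_map_eq_C_mul (R := R) a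
  obtain ⟨d₂, hd₂, b', hb'⟩ := exists_map_eq_C_mul (R := R) b
  obtain ⟨d₃, hd₃, q', hq'⟩ := exists_map_eq_C_mul (R := R) q
  obtain ⟨d₄, hd₄, w', hw'⟩ := exists_map_eq_C_mul (R := R) w
  have e₁ : C d₂ * a' * g + C d₁ * b' * derivative g = C (d₁ * d₂) := by
    apply hminj
    simp only [Polynomial.map_add, Polynomial.map_mul, map_C, ha', hb', ← derivative_map, map_mul]
    linear_combination C (algebraMap R K d₁) * C (algebraMap R K d₂) * hab
  have e₂ : C d₃ * g ^ n = f * (C c ^ n * q') := by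
    apply hminj
    simp only [Polynomial.map_mul, Polynomial.map_pow, map_C, hq', hg, ← hF]
    linear_combination C (algebraMap R K d₃) * C (algebraMap R K c) ^ n * hq
  have e₃ : C (c * d₄) * f = g * w' := by
    apply hminj
    simp only [Polynomial.map_mul, map_C, hw', hg, ← hF, map_mul]
    linear_combination C (algebraMap R K d₄) * C (algebraMap R K c) * hw
  -- One `D` must serve all the identities, so it is the product of all denominators and the leading
  -- coefficient.
  refine ⟨d₁ * d₂ * d₃ * (c * d₄) * g.leadingCoeff, g, ?_, ⟨C (d₃ * (c * d₄) * g.leadingCoeff) *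
    (C d₂ * a'), C (d₃ * (c * d₄) * g.leadingCoeff) * (C d₁ * b'), ?_⟩,
    ⟨n, C (d₁ * d₂ * (c * d₄) * g.leadingCoeff) * (C c ^ n * q'), ?_⟩,
    ⟨C (d₁ * d₂ * d₃ * g.leadingCoeff) * w', ?_⟩, Dvd.intro_left _ rfl⟩
  · simp [hd₁, hd₂, hd₃, hd₄, hc, hg0]
  · simp only [map_mul] at e₁ ⊢
    linear_combination C d₃ * (C c * C d₄) * C g.leadingCoeff * e₁
  · simp only [map_mul] at e₂ ⊢
    linear_combination C d₁ * C d₂ * (C c * C d₄) * C g.leadingCoeff * e₂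
  · simp only [map_mul] at e₃ ⊢
    linear_combination C d₁ * C d₂ * C d₃ * C g.leadingCoeff * e₃

/-! ### Zeros of a polynomial with varying coefficients -/

theorem continuous_eval₂_of_continuous {E R : Type*} [TopologicalSpace E] [CommRing R]
    {e : E → R →+* ℝ} (he : ∀ r, Continuous fun x => e x r) (g : Polynomial R) :
    Continuous fun p : E × ℝ => g.eval₂ (e p.1) p.2 := by
  simp only [Polynomial.eval₂_eq_sum_range]
  exact continuous_finsetSum _ fun i _ =>
    ((he _).comp continuous_fst).mul (continuous_snd.pow i)

open Topology Filter in
/-- Where the leading coefficient does not vanish, the zeros are locally bounded. -/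
theorem exists_eventually_eval₂_ne_zero {E R : Type*} [TopologicalSpace E] [CommRing R]
    {e : E → R →+* ℝ} (he : ∀ r, Continuous fun x => e x r) (g : Polynomial R) {x₀ : E}
    (hx₀ : e x₀ g.leadingCoeff ≠ 0) :
    ∃ M : ℝ, ∀ᶠ x in 𝓝 x₀, ∀ t : ℝ, M < |t| → g.eval₂ (e x) t ≠ 0 := by
  -- A large zero `t` of `g` gives the zero `1/t` of the reversed polynomial, whose value at `0` is
  -- the leading coefficient.
  have h := (continuous_eval₂_of_continuous he g.reverse).continuousAt (x := (x₀, 0))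
  have h0 : g.reverse.eval₂ (e x₀) 0 ≠ 0 := by
    rwa [Polynomial.eval₂_at_zero, Polynomial.coeff_zero_reverse]
  have h1 := h.eventually_ne h0
  rw [nhds_prod_eq] at h1
  obtain ⟨pa, ha, pb, hb, hab⟩ := eventually_prod_iff.1 h1
  obtain ⟨ε, hε, hball⟩ := Metric.eventually_nhds_iff.1 hb
  refine ⟨ε⁻¹, ha.mono fun x hx t ht h2 => ?_⟩
  have ht0 : 0 < |t| := (inv_pos.2 hε).trans ht
  have ht1 : t ≠ 0 := abs_pos.1 ht0
  let := invertibleOfNonzero ht1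
  rw [← Polynomial.eval₂_reverse_mul_pow] at h2
  refine hab hx (hball ?_ : pb (⅟t)) ((mul_eq_zero.1 h2).resolve_right (pow_ne_zero _ ht1))
  rw [invOf_eq_inv, Real.dist_eq, sub_zero, abs_inv]
  exact inv_lt_of_inv_lt₀ hε ht

open Topology Filter in
/-- Near a simple zero or a point that is not a zero, points can be moved to every nearby fibre
inside the complement of the zeros. -/
theorem eventually_joinedIn_fiber {E R : Type*} [NormedAddCommGroup E] [NormedSpace ℝ E]
    [CommRing R] {e : E → R →+* ℝ} (he : ∀ r, Continuous fun x => e x r) (g : Polynomial R)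
    {U : Set E} (hU : IsOpen U) {x₀ : E} (hx₀ : x₀ ∈ U) (t₀ : ℝ)
    (h : g.eval₂ (e x₀) t₀ ≠ 0 ∨ g.derivative.eval₂ (e x₀) t₀ ≠ 0) :
    ∀ᶠ p : (E × E) × ℝ in 𝓝 ((x₀, x₀), t₀), g.eval₂ (e p.1.1) p.2 ≠ 0 →
      ∃ t, JoinedIn {q : E × ℝ | q.1 ∈ U ∧ g.eval₂ (e q.1) q.2 ≠ 0} (p.1.1, p.2) (p.1.2, t) := by
  have hcont := continuous_eval₂_of_continuous he g
  set W : Set (E × ℝ) := {q | q.1 ∈ U ∧ g.eval₂ (e q.1) q.2 ≠ 0}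
  have horiz : ∀ t, g.eval₂ (e x₀) t ≠ 0 → ∃ δ > 0, ∀ x ∈ Metric.ball x₀ δ,
      ∀ y ∈ Metric.ball x₀ δ, ∀ s ∈ Metric.ball t δ, JoinedIn W (x, s) (y, s) := by
    intro t ht
    have hWt : W ∈ 𝓝 (x₀, t) :=
      ((hU.preimage continuous_fst).inter (isOpen_ne_fun hcont continuous_const)).mem_nhds ⟨hx₀, ht⟩
    obtain ⟨δ, hδ, hball⟩ := Metric.mem_nhds_iff.1 hWt
    rw [← ball_prod_same] at hball
    refine ⟨δ, hδ, fun x hx y hy s hs => JoinedIn.of_segment_subset ?_⟩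
    exact (((convex_ball x₀ δ).prod (convex_ball t δ)).segment_subset ⟨hx, hs⟩ ⟨hy, hs⟩).trans hball
  have near : ∀ δ > 0, ∀ᶠ p : (E × E) × ℝ in 𝓝 ((x₀, x₀), t₀),
      p.1.1 ∈ Metric.ball x₀ δ ∧ p.1.2 ∈ Metric.ball x₀ δ ∧ p.2 ∈ Metric.ball t₀ δ := by
    intro δ hδ
    filter_upwards [Metric.ball_mem_nhds (((x₀, x₀), t₀) : (E × E) × ℝ) hδ] with p hp
    rw [← ball_prod_same, ← ball_prod_same] at hp
    exact ⟨hp.1.1, hp.1.2, hp.2⟩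
  by_cases h0 : g.eval₂ (e x₀) t₀ = 0
  · have hder := h.resolve_left (not_not.2 h0)
    have hWt : {q : E × ℝ | q.1 ∈ U ∧ g.derivative.eval₂ (e q.1) q.2 ≠ 0} ∈ 𝓝 (x₀, t₀) :=
      ((hU.preimage continuous_fst).inter (isOpen_ne_fun
        (continuous_eval₂_of_continuous he _) continuous_const)).mem_nhds ⟨hx₀, hder⟩
    obtain ⟨δ, hδ, hball⟩ := Metric.mem_nhds_iff.1 hWt
    rw [← ball_prod_same] at hball
    -- By Rolle, each nearby fibre has at most one zero within `δ` of `t₀`. In particular `t₀ ± δ /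
    -- 2` are not zeros over `x₀`.
    have rolle : ∀ x ∈ Metric.ball x₀ δ, ∀ s t, s < t → t₀ - δ < s → t < t₀ + δ →
        g.eval₂ (e x) s = 0 → g.eval₂ (e x) t = 0 → False := by
      intro x hx s t hst hs ht h1 h2
      have hd : ∀ r, HasDerivAt (fun r => g.eval₂ (e x) r) (g.derivative.eval₂ (e x) r) r := by
        intro r
        have := (g.map (e x)).hasDerivAt r
        simpa [Polynomial.derivative_map, Polynomial.eval_map] using this
      obtain ⟨c, hc, hc0⟩ := exists_hasDerivAt_eq_zero hst
        (fun r _ => (hd r).continuousAt.continuousWithinAt) (h1.trans h2.symm) (fun r _ => hd r)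
      refine (hball (Set.mk_mem_prod hx (?_ : c ∈ Metric.ball t₀ δ))).2 hc0
      rw [Real.ball_eq_Ioo]
      exact ⟨hs.trans hc.1, hc.2.trans ht⟩
    have hx₀δ : x₀ ∈ Metric.ball x₀ δ := Metric.mem_ball_self hδ
    obtain ⟨δ₁, hδ₁, h₁⟩ := horiz (t₀ - δ / 2)
      fun h' => rolle x₀ hx₀δ _ t₀ (by linarith) (by linarith) (by linarith) h' h0
    obtain ⟨δ₂, hδ₂, h₂⟩ := horiz (t₀ + δ / 2)
      fun h' => rolle x₀ hx₀δ t₀ _ (by linarith) (by linarith) (by linarith) h0 h'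
    have vert : ∀ x ∈ Metric.ball x₀ δ, ∀ s t, (∀ r ∈ Set.uIcc s t, g.eval₂ (e x) r ≠ 0) →
        JoinedIn W (x, s) (x, t) := by
      intro x hx s t hst
      have hxU : x ∈ U := (hball (Set.mk_mem_prod hx (Metric.mem_ball_self hδ))).1
      apply JoinedIn.of_segment_subset
      rw [← Prod.image_mk_segment_right, segment_eq_uIcc]
      rintro _ ⟨r, hr, rfl⟩
      exact ⟨hxU, hst r hr⟩
    filter_upwards [near _ (half_pos hδ), near δ₁ hδ₁, near δ₂ hδ₂]
    rintro ⟨⟨x, y⟩, t⟩ ⟨hx, -, ht⟩ ⟨hx₁, hy₁, -⟩ ⟨hx₂, hy₂, -⟩ hne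
    dsimp only at *
    have hxδ : x ∈ Metric.ball x₀ δ := Metric.ball_subset_ball (by linarith) hx
    rw [Real.ball_eq_Ioo] at ht
    -- At most one zero lies nearby, so one of the two ways from `t`, up to `t₀ + δ / 2` or down to
    -- `t₀ - δ / 2`, is free of zeros. At that height the base point can be changed from `x` to `y`.
    by_cases hup : ∀ r ∈ Set.uIcc t (t₀ + δ / 2), g.eval₂ (e x) r ≠ 0
    · exact ⟨_, (vert x hxδ _ _ hup).trans (h₂ x hx₂ y hy₂ _ (Metric.mem_ball_self hδ₂))⟩
    · refine ⟨_, (vert x hxδ _ _ fun r hr h' => hup fun r' hr' h'' => ?_).trans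
        (h₁ x hx₁ y hy₁ _ (Metric.mem_ball_self hδ₁))⟩
      rw [Set.uIcc_of_ge ht.1.le] at hr
      rw [Set.uIcc_of_le ht.2.le] at hr'
      have hrt : r ≠ t := by rintro rfl; exact hne h'
      have := lt_of_le_of_ne hr.2 hrt
      exact rolle x hxδ r r' (this.trans_le hr'.1) (by linarith [hr.1]) (by linarith [hr'.2]) h' h''
  · obtain ⟨δ, hδ, hj⟩ := horiz t₀ h0
    filter_upwards [near δ hδ] with p hp _
    exact ⟨p.2, hj _ hp.1 _ hp.2.1 _ hp.2.2⟩

open Topology Filter in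
/-- Over a region where all zeros are simple and the leading coefficient does not vanish, points
outside the zeros can be moved to the fibre over the end point of a path. -/
theorem exists_joinedIn_fiber {E R : Type*} [NormedAddCommGroup E] [NormedSpace ℝ E]
    [CommRing R] {e : E → R →+* ℝ} (he : ∀ r, Continuous fun x => e x r) (g : Polynomial R)
    {U : Set E} (hU : IsOpen U) (hlc : ∀ x ∈ U, e x g.leadingCoeff ≠ 0)
    (hsimple : ∀ x ∈ U, ∀ t, g.eval₂ (e x) t ≠ 0 ∨ g.derivative.eval₂ (e x) t ≠ 0)
    {x y : E} (hxy : JoinedIn U x y) (t : ℝ) (ht : g.eval₂ (e x) t ≠ 0) :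
    ∃ s, JoinedIn {q : E × ℝ | q.1 ∈ U ∧ g.eval₂ (e q.1) q.2 ≠ 0} (x, t) (y, s) := by
  set W : Set (E × ℝ) := {q | q.1 ∈ U ∧ g.eval₂ (e q.1) q.2 ≠ 0}
  let P : E → E → Prop := fun x y => ∀ t, g.eval₂ (e x) t ≠ 0 → ∃ s, JoinedIn W (x, t) (y, s)
  have hloc : ∀ x₀ ∈ U, ∀ᶠ p : E × E in 𝓝 (x₀, x₀), P p.1 p.2 := by
    intro x₀ hx₀
    obtain ⟨M, hM⟩ := exists_eventually_eval₂_ne_zero he g (hlc x₀ hx₀)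
    -- Compactness gives one neighbourhood for all heights in `[-M, M]`. Higher up there are no
    -- zeros, and horizontal segments suffice.
    have hcpt := (isCompact_Icc (a := -M) (b := M)).eventually_forall_of_forall_eventually
      (x₀ := ((x₀, x₀) : E × E))
      (P := fun p t => g.eval₂ (e p.1) t ≠ 0 → ∃ s, JoinedIn W (p.1, t) (p.2, s))
      fun t _ => eventually_joinedIn_fiber he g hU hx₀ t (hsimple x₀ hx₀ t)
    obtain ⟨δ, hδ, hball⟩ := Metric.eventually_nhds_iff_ball.1 (hM.and (hU.mem_nhds hx₀))
    filter_upwards [hcpt, Metric.ball_mem_nhds ((x₀, x₀) : E × E) hδ] with p hp hpb t ht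
    rw [← ball_prod_same] at hpb
    by_cases htM : |t| ≤ M
    · exact hp t (abs_le.1 htM) ht
    · refine ⟨t, JoinedIn.of_segment_subset ?_⟩
      rw [← Prod.image_mk_segment_left]
      rintro _ ⟨z, hz, rfl⟩
      have hz' := hball z ((convex_ball x₀ δ).segment_subset hpb.1 hpb.2 hz)
      exact ⟨hz'.2, hz'.1 t (not_le.1 htM)⟩
  obtain ⟨γ, hγ⟩ := hxy
  have hpre : IsPreconnected (Set.range γ) := isPreconnected_range γ.continuous
  -- `P` is transitive but not visibly symmetric. The induction along the connected range of the
  -- path needs a symmetric relation.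
  have key : P x y ∧ P y x := by
    refine hpre.induction₂ (fun x y => P x y ∧ P y x) ?_ ?_ (fun _ _ _ _ h => h.symm)
      ⟨0, γ.source⟩ ⟨1, γ.target⟩
    · rintro _ ⟨r, rfl⟩
      have h := hloc _ (hγ r)
      refine nhdsWithin_le_nhds ?_
      exact ((Continuous.prodMk_right (γ r)).tendsto _ |>.eventually h).and
        ((Continuous.prodMk_left (γ r)).tendsto _ |>.eventually h)
    · rintro a b c - - - ⟨h1, h2⟩ ⟨h3, h4⟩
      have tr : ∀ {a b c}, P a b → P b c → P a c := by
        intro a b c h h' t ht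
        obtain ⟨s, hs⟩ := h t ht
        obtain ⟨r, hr⟩ := h' s hs.target_mem.2
        exact ⟨r, hs.trans hr⟩
      exact ⟨tr h1 h3, tr h4 h2⟩
  exact key.1 t ht

/-! ### Sets with finitely many path components -/

/-- Finitely many points represent all path components of the subset `U`. -/
def HasFinitelyManyPathComponents {X : Type*} [TopologicalSpace X] (U : Set X) : Prop :=
  ∃ S : Set X, S.Finite ∧ ∀ x ∈ U, ∃ s ∈ S, JoinedIn U s x

namespace HasFinitelyManyPathComponents

variable {X Y : Type*} [TopologicalSpace X] [TopologicalSpace Y]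

theorem of_finite_invariant {T : Type*} [Finite T] {U : Set X} (h : X → T)
    (hU : ∀ x ∈ U, ∀ y ∈ U, h x = h y → JoinedIn U x y) : HasFinitelyManyPathComponents U := by
  classical
  rcases isEmpty_or_nonempty X with hX | hX
  · exact ⟨∅, Set.finite_empty, fun x => (hX.false x).elim⟩
  -- Values not attained on `U` yield arbitrary points, which do no harm: the representatives need
  -- not lie in `U`.
  refine ⟨Set.range fun t => Function.invFunOn h U t, Set.finite_range _, fun x hx =>
    ⟨_, ⟨h x, rfl⟩, ?_⟩⟩
  have hex : ∃ a ∈ U, h a = h x := ⟨x, hx, rfl⟩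
  exact hU _ (Function.invFunOn_mem hex) _ hx (Function.invFunOn_eq hex)

theorem image {U : Set X} {V : Set Y} (hU : HasFinitelyManyPathComponents U) {f : X → Y}
    (hf : ContinuousOn f U) (hUV : f '' U = V) : HasFinitelyManyPathComponents V := by
  obtain ⟨S, hS, h⟩ := hU
  refine ⟨f '' S, hS.image f, ?_⟩
  subst hUV
  rintro _ ⟨x, hx, rfl⟩
  obtain ⟨s, hs, hj⟩ := h x hx
  exact ⟨f s, Set.mem_image_of_mem f hs, hj.map_continuousOn hf⟩

theorem univ_subtype {U : Set X} (hU : HasFinitelyManyPathComponents U) :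
    HasFinitelyManyPathComponents (Set.univ : Set U) := by
  obtain ⟨S, hS, h⟩ := hU
  refine ⟨Subtype.val ⁻¹' S, hS.preimage Subtype.val_injective.injOn, fun x _ => ?_⟩
  obtain ⟨s, hs, hj⟩ := h x x.2
  exact ⟨⟨s, hj.source_mem⟩, hs, joinedIn_univ.2 hj.joined_subtype⟩

/-- It suffices to join the points of `V` in `V` to the points of a smaller set. -/
theorem of_subset {U V : Set X} (hU : HasFinitelyManyPathComponents U) (hUV : U ⊆ V)
    (h : ∀ x ∈ V, ∃ y ∈ U, JoinedIn V y x) : HasFinitelyManyPathComponents V := by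
  obtain ⟨S, hS, hj⟩ := hU
  refine ⟨S, hS, fun x hx => ?_⟩
  obtain ⟨y, hy, hyx⟩ := h x hx
  obtain ⟨s, hs, hsy⟩ := hj y hy
  exact ⟨s, hs, (hsy.mono hUV).trans hyx⟩

/-- The set of points of `Z` below `t` determines the component of `t`. -/
theorem compl_finset (Z : Finset ℝ) : HasFinitelyManyPathComponents {t : ℝ | t ∉ Z} := by
  have key : ∀ t ∉ Z, ∀ t' ∉ Z, t ≤ t' → Z.filter (· < t) = Z.filter (· < t') →
      JoinedIn {t : ℝ | t ∉ Z} t t' := by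
    intro t ht t' ht' hle h
    apply JoinedIn.of_segment_subset
    rw [segment_eq_Icc hle]
    intro r hr hrZ
    have h1 : r ∈ Z.filter (· < t') :=
      Finset.mem_filter.2 ⟨hrZ, lt_of_le_of_ne hr.2 fun h => ht' (h ▸ hrZ)⟩
    rw [← h] at h1
    exact absurd (Finset.mem_filter.1 h1).2 (not_lt.2 hr.1)
  refine of_finite_invariant (T := Z.powerset)
    (fun t => ⟨Z.filter (· < t), Finset.mem_powerset.2 (Finset.filter_subset _ _)⟩) ?_
  intro t ht t' ht' h
  have h' := congrArg Subtype.val h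
  rcases le_total t t' with hle | hle
  · exact key t ht t' ht' hle h'
  · exact (key t' ht' t ht hle h'.symm).symm

/-- Every point can be carried to the fibre over one of the finitely many representatives of `U`,
and each such fibre is a line without finitely many zeros. -/
theorem of_simple_zeros {E R : Type*} [NormedAddCommGroup E] [NormedSpace ℝ E]
    [CommRing R] {e : E → R →+* ℝ} (he : ∀ r, Continuous fun x => e x r) (g : Polynomial R)
    {U : Set E} (hU : IsOpen U) (hlc : ∀ x ∈ U, e x g.leadingCoeff ≠ 0)
    (hsimple : ∀ x ∈ U, ∀ t, g.eval₂ (e x) t ≠ 0 ∨ g.derivative.eval₂ (e x) t ≠ 0)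
    (hfin : HasFinitelyManyPathComponents U) :
    HasFinitelyManyPathComponents {q : E × ℝ | q.1 ∈ U ∧ g.eval₂ (e q.1) q.2 ≠ 0} := by
  obtain ⟨S, hS, hj⟩ := hfin
  have hfib : ∀ x ∈ U, HasFinitelyManyPathComponents {t : ℝ | g.eval₂ (e x) t ≠ 0} := by
    intro x hx
    have h0 : g.map (e x) ≠ 0 := fun h => hlc x hx <| by
      rw [Polynomial.leadingCoeff, ← Polynomial.coeff_map, h, Polynomial.coeff_zero]
    have := compl_finset (g.map (e x)).roots.toFinset
    simpa [h0, Polynomial.eval_map] using this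
  choose! T hT hTj using hfib
  refine ⟨⋃ x ∈ S ∩ U, Prod.mk x '' T x, (hS.inter_of_left U).biUnion fun x hx =>
    (hT x hx.2).image _, ?_⟩
  rintro ⟨x, t⟩ ⟨hx, ht⟩
  obtain ⟨y, hy, hyx⟩ := hj x hx
  have hyU := hyx.source_mem
  obtain ⟨s, hs⟩ := exists_joinedIn_fiber he g hU hlc hsimple hyx.symm t ht
  obtain ⟨r, hr, hrs⟩ := hTj y hyU s hs.target_mem.2
  refine ⟨(y, r), Set.mem_biUnion ⟨hy, hyU⟩ ⟨r, hr, rfl⟩, JoinedIn.trans ?_ hs.symm⟩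
  refine (hrs.map (f := Prod.mk y) (by fun_prop)).mono ?_
  rintro _ ⟨r', hr', rfl⟩
  exact ⟨hyU, hr'⟩

end HasFinitelyManyPathComponents

/-! ### Complements of real hypersurfaces -/

/-- A ball in the sup norm is a product of infinite sets, on which only the zero polynomial
vanishes. -/
theorem MvPolynomial.exists_mem_eval_ne_zero {n : ℕ} {D : MvPolynomial (Fin n) ℝ} (hD : D ≠ 0)
    {O : Set (Fin n → ℝ)} (hO : IsOpen O) (hne : O.Nonempty) : ∃ x ∈ O, eval x D ≠ 0 := by
  by_contra! h
  obtain ⟨x, hx⟩ := hne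
  obtain ⟨ε, hε, hball⟩ := Metric.isOpen_iff.1 hO x hx
  refine hD (funext_set (fun i => Metric.ball (x i) ε) (fun i => ?_) fun y hy => ?_)
  · rw [Real.ball_eq_Ioo]
    exact Set.Ioo_infinite (by linarith)
  · rw [map_zero]
    refine h y (hball ?_)
    rw [ball_pi _ hε]
    exact hy

open HasFinitelyManyPathComponents in
/-- The complement of a real algebraic hypersurface has finitely many path components. -/
theorem MvPolynomial.hasFinitelyManyPathComponents {n : ℕ} (f : MvPolynomial (Fin n) ℝ) :
    HasFinitelyManyPathComponents {x : Fin n → ℝ | eval x f ≠ 0} := by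
  induction n with
  | zero => exact of_finite_invariant (fun _ => ()) fun x hx y _ _ =>
      Subsingleton.elim x y ▸ JoinedIn.refl hx
  | succ n ih =>
    by_cases hf : f = 0
    · exact ⟨∅, Set.finite_empty, fun x hx => absurd (by simp [hf]) hx⟩
    obtain ⟨D, g, hD, ⟨a, b, hab⟩, ⟨k, u, hu⟩, ⟨v, hv⟩, w, hw⟩ := exists_separable_model
      (f := finSuccEquiv ℝ n f) ((EmbeddingLike.map_ne_zero_iff).2 hf)
    let e : (Fin n → ℝ) → MvPolynomial (Fin n) ℝ →+* ℝ := fun x => eval x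
    have he : ∀ r, Continuous fun x => e x r := fun r => continuous_eval r
    have h1 := of_simple_zeros he g (U := {x | eval x D ≠ 0})
      (isOpen_ne_fun (he D) continuous_const) (fun x hx h0 => hx ?_) (fun x hx t => ?_) (ih D)
    · have hcons : ∀ q : (Fin n → ℝ) × ℝ, eval (Fin.cons q.2 q.1 : Fin (n + 1) → ℝ) f =
          (finSuccEquiv ℝ n f).eval₂ (e q.1) q.2 := fun q => by
        rw [eval_eq_eval_mv_eval', Polynomial.eval_map]
      have hc : Continuous fun q : (Fin n → ℝ) × ℝ => (Fin.cons q.2 q.1 : Fin (n + 1) → ℝ) := by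
        fun_prop
      refine (h1.image (f := fun q => (Fin.cons q.2 q.1 : Fin (n + 1) → ℝ)) hc.continuousOn
        rfl).of_subset ?_ ?_
      -- Where `D` and `g` do not vanish, `D * g ^ k = f * u` shows that `f` does not vanish either.
      · rintro _ ⟨q, ⟨hq, hq'⟩, rfl⟩
        simp only [Set.mem_ofPred_eq, hcons] at hq hq' ⊢
        intro h
        have := congrArg (Polynomial.eval₂ (e q.1) q.2) hu
        simp only [Polynomial.eval₂_mul, Polynomial.eval₂_pow, Polynomial.eval₂_C, h, zero_mul]
          at this
        exact mul_ne_zero hq (pow_ne_zero _ hq') this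
      -- The locus `D = 0` has empty interior, so a short segment inside `f ≠ 0` leads off it; there
      -- `D * f = g * v` gives `g ≠ 0`.
      · intro x hx
        obtain ⟨ε, hε, hball⟩ := Metric.isOpen_iff.1
          (isOpen_ne_fun (continuous_eval f) continuous_const) x hx
        obtain ⟨y, hy, hyD⟩ := exists_mem_eval_ne_zero hD (Metric.isOpen_ball (ε := ε)
          (x := Fin.tail x)) ⟨_, Metric.mem_ball_self hε⟩
        have hmem : (Fin.cons (x 0) y : Fin (n + 1) → ℝ) ∈ Metric.ball x ε := by
          rw [Metric.mem_ball, dist_pi_lt_iff hε] at hy ⊢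
          refine Fin.cases (by simpa using hε) fun i => ?_
          simpa [Fin.tail] using hy i
        have hne := hball hmem
        rw [Set.mem_ofPred_eq, hcons (y, x 0)] at hne
        refine ⟨_, ⟨(y, x 0), ⟨hyD, fun h => ?_⟩, rfl⟩, JoinedIn.of_segment_subset
          (((convex_ball x ε).segment_subset hmem (Metric.mem_ball_self hε)).trans hball)⟩
        have := congrArg (Polynomial.eval₂ (e y) (x 0)) hv
        simp only [Polynomial.eval₂_mul, Polynomial.eval₂_C] at this h
        rw [h, zero_mul] at this
        exact mul_ne_zero hyD hne this
    · change e x D = 0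
      rw [hw, map_mul, h0, zero_mul]
    · by_contra! h
      have := congrArg (Polynomial.eval₂ (e x) t) hab
      simp only [Polynomial.eval₂_add, Polynomial.eval₂_mul, Polynomial.eval₂_C, h.1, h.2,
        mul_zero, add_zero] at this
      exact hx this.symm

theorem MvPolynomial.hasFinitelyManyPathComponents_of_finite {σ : Type*} [Finite σ]
    (f : MvPolynomial σ ℝ) : HasFinitelyManyPathComponents {x : σ → ℝ | eval x f ≠ 0} := by
  obtain ⟨n, ⟨e⟩⟩ := Finite.exists_equiv_fin σ
  refine (rename e f).hasFinitelyManyPathComponents.image (f := fun x => x ∘ e)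
    (by fun_prop) ?_
  ext x
  constructor
  · rintro ⟨y, hy, rfl⟩
    rwa [Set.mem_ofPred_eq, eval_rename] at hy
  · intro hx
    refine ⟨x ∘ e.symm, ?_, by ext i; simp⟩
    rw [Set.mem_ofPred_eq, eval_rename]
    simpa [Function.comp_def] using hx

/-! ### Kernels of transversal matrices of odd order -/

namespace IsTransversalMatrix

variable {κ : Type*} [Fintype κ] [DecidableEq κ] {M : Matrix κ κ ℝ}

/-- In odd order, a vector with `y i = 0` is zero as soon as all entries of `M y` but the `i`-th
vanish. -/
theorem eq_zero_of_mulVec (hM : IsTransversalMatrix M) (hκ : Odd (Fintype.card κ)) {y : κ → ℝ}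
    {i : κ} (hi : y i = 0) (hy : ∀ k ≠ i, M.mulVec y k = 0) : y = 0 := by
  have hcard : Even (Finset.univ.erase i).card := by
    rw [Finset.card_erase_of_mem (Finset.mem_univ i), Finset.card_univ]
    exact Nat.Odd.sub_odd hκ odd_one
  have h := Matrix.eq_zero_of_mulVec_eq_zero (hM _ hcard)
    (v := fun k : (Finset.univ.erase i : Finset κ) => y k) <| by
      funext k
      rw [Pi.zero_apply, ← hy k (Finset.ne_of_mem_erase k.2)]
      simp only [Matrix.mulVec, dotProduct, Matrix.submatrix_apply]
      rw [Finset.sum_coe_sort (Finset.univ.erase i) (fun j => M k j * y j)]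
      exact Finset.sum_erase _ (by rw [hi, mul_zero])
  funext k
  by_cases hk : k = i
  · rw [hk, hi, Pi.zero_apply]
  · exact congrFun h ⟨k, Finset.mem_erase.2 ⟨hk, Finset.mem_univ k⟩⟩

/-- This entry is the determinant of `M` with row `j` replaced by a unit vector. A kernel vector of
that matrix has `j`-th entry zero and is annihilated by all other rows of `M`. -/
theorem adjugate_self_ne_zero (hM : IsTransversalMatrix M) (hκ : Odd (Fintype.card κ)) (j : κ) :
    M.adjugate j j ≠ 0 := by
  rw [Matrix.adjugate_apply]
  intro h
  obtain ⟨v, hv, h0⟩ := Matrix.exists_mulVec_eq_zero_iff.2 h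
  refine hv (hM.eq_zero_of_mulVec hκ (i := j) ?_ fun k hk => ?_)
  · have := congrFun h0 j
    simpa [Matrix.mulVec] using this
  · have := congrFun h0 k
    simpa [Matrix.mulVec, hk] using this

/-- A skew-symmetric matrix of odd order is singular, so its product with its adjugate is zero. -/
theorem _root_.Matrix.mulVec_adjugate_col_of_skew (hskew : ∀ k i, M k i = -M i k) (hκ : Odd (Fintype.card κ)) (j : κ) :
    M.mulVec (fun i => M.adjugate i j) = 0 := by
  have hT : M.transpose = -M := by
    ext k i
    exact hskew i k
  have hdet : M.det = 0 := by
    have h := M.det_transpose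
    rw [hT, Matrix.det_neg, hκ.neg_one_pow] at h
    linarith
  have h := M.mul_adjugate
  rw [hdet, zero_smul] at h
  funext k
  exact congrFun (congrFun h k) j

/-- Column `j` is a kernel vector; one zero entry would make it vanish, contrary to its nonzero
diagonal entry. -/
theorem adjugate_ne_zero (hM : IsTransversalMatrix M) (hskew : ∀ k i, M k i = -M i k)
    (hκ : Odd (Fintype.card κ)) (i j : κ) : M.adjugate i j ≠ 0 := fun h =>
  hM.adjugate_self_ne_zero hκ j <| congrFun (hM.eq_zero_of_mulVec hκ (i := i)
    (y := fun i => M.adjugate i j) h fun k _ => congrFun (Matrix.mulVec_adjugate_col_of_skew hskew hκ j) k) j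

/-- The kernel has dimension at most one, and its nonzero vectors have no zero entry. -/
theorem mul_eq_mul_of_mulVec_eq_zero (hM : IsTransversalMatrix M) (hκ : Odd (Fintype.card κ))
    {x y : κ → ℝ} (hx : M.mulVec x = 0) (hy : M.mulVec y = 0) (i k : κ) :
    x i * y k = y i * x k := by
  -- This kernel vector is chosen to have `i`-th entry zero.
  have h := hM.eq_zero_of_mulVec hκ (i := i) (y := x i • y - y i • x)
    (by simp [mul_comm]) fun k _ => by
      rw [Matrix.mulVec_sub, Matrix.mulVec_smul, Matrix.mulVec_smul, hx, hy]
      simp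
  have := congrFun h k
  simp only [Pi.sub_apply, Pi.smul_apply, smul_eq_mul, Pi.zero_apply] at this
  linarith

end IsTransversalMatrix

/-! ### Fixed points and their supports -/

/-- The principal submatrix with rows and columns in `β`. -/
abbrev Matrix.principal {ι R : Type*} (A : Matrix ι ι R) (β : Finset ι) : Matrix β β R :=
  A.submatrix (fun i : β => (i : ι)) (fun i : β => (i : ι))

/-- For a transversal skew-symmetric matrix: `β` is the support of a fixed point of the Volterra
operator. -/
def IsFixSupport {ι : Type*} [DecidableEq ι] (A : Matrix ι ι ℝ) (β : Finset ι) : Prop :=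
  Odd β.card ∧ ∀ i i' j : β, 0 < (A.principal β).adjugate i j * (A.principal β).adjugate i' j

section FixedPoints

variable {ι : Type*} [Fintype ι] {A : Matrix ι ι ℝ}
  {V : stdSimplex ℝ ι → stdSimplex ℝ ι}

/-- The set of vertices of the smallest face that contains `x`. -/
noncomputable def simplexSupport (x : stdSimplex ℝ ι) : Finset ι :=
  Finset.univ.filter fun k => x k ≠ 0

theorem mem_simplexSupport {x : stdSimplex ℝ ι} {k : ι} : k ∈ simplexSupport x ↔ x k ≠ 0 := by
  simp [simplexSupport]

theorem IsVolterraOpOf.isFixed_iff (hV : IsVolterraOpOf A V) (x : stdSimplex ℝ ι) :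
    V x = x ↔ ∀ k, x k * ∑ i, A k i * x i = 0 := by
  constructor
  · intro h k
    have h1 := hV.2 x k
    rw [h] at h1
    linarith
  · intro h
    refine Subtype.ext (funext fun k => ?_)
    have h1 := hV.2 x k
    have h2 := h k
    change V x k = x k
    linarith

theorem IsVolterraOpOf.mulVec_principal (hV : IsVolterraOpOf A V) {x : stdSimplex ℝ ι}
    (hx : V x = x) {β : Finset ι} (hβ : simplexSupport x = β) :
    (A.principal β).mulVec (fun k : β => x k) = 0 := by
  subst hβ
  funext k
  have h := (mul_eq_zero.1 ((hV.isFixed_iff x).1 hx k)).resolve_left (mem_simplexSupport.1 k.2)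
  rw [Pi.zero_apply, ← h]
  simp only [Matrix.mulVec, dotProduct, Matrix.submatrix_apply]
  rw [Finset.sum_coe_sort (simplexSupport x) (fun i => A k i * x i)]
  refine Finset.sum_subset (Finset.subset_univ _) fun i _ hi => ?_
  rw [mem_simplexSupport, not_not] at hi
  rw [hi, mul_zero]

variable [DecidableEq ι]

theorem odd_card_simplexSupport (hV : IsVolterraOpOf A V) (hA : IsTransversalMatrix A)
    {x : stdSimplex ℝ ι} (hx : V x = x) : Odd (simplexSupport x).card := by
  by_contra h
  rw [Nat.not_odd_iff_even] at h
  have h0 := Matrix.eq_zero_of_mulVec_eq_zero (hA _ h) (hV.mulVec_principal hx rfl)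
  have h1 : ∀ k, x k = 0 := by
    intro k
    by_contra hk
    exact hk (congrFun h0 ⟨k, mem_simplexSupport.2 hk⟩)
  have h2 := stdSimplex.sum_eq_one x
  simp [h1] at h2

/-- Two fixed points with the same support span the same kernel line, and coordinate sum one singles
out a point on it. -/
theorem simplexSupport_injOn (hV : IsVolterraOpOf A V) (hA : IsTransversalMatrix A) :
    Set.InjOn simplexSupport {x | V x = x} := by
  intro x hx y hy hxy
  have hodd : Odd (Fintype.card (simplexSupport y)) := by
    rw [Fintype.card_coe]
    exact odd_card_simplexSupport hV hA hy
  have hmul : ∀ i k, x i * y k = y i * x k := by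
    intro i k
    by_cases hi : i ∈ simplexSupport y
    · by_cases hk : k ∈ simplexSupport y
      · exact (hA.restrict _).mul_eq_mul_of_mulVec_eq_zero hodd (hV.mulVec_principal hx hxy)
          (hV.mulVec_principal hy rfl) ⟨i, hi⟩ ⟨k, hk⟩
      · have h1 : x k = 0 := by rwa [← hxy, mem_simplexSupport, not_not] at hk
        have h2 : y k = 0 := by rwa [mem_simplexSupport, not_not] at hk
        rw [h1, h2, mul_zero, mul_zero]
    · have h1 : x i = 0 := by rwa [← hxy, mem_simplexSupport, not_not] at hi
      have h2 : y i = 0 := by rwa [mem_simplexSupport, not_not] at hi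
      rw [h1, h2, zero_mul, zero_mul]
  refine Subtype.ext (funext fun i => ?_)
  change x i = y i
  have h := Finset.sum_congr (rfl : (Finset.univ : Finset ι) = _) fun k _ => hmul i k
  rwa [← Finset.mul_sum, ← Finset.mul_sum, stdSimplex.sum_eq_one, stdSimplex.sum_eq_one, mul_one,
    mul_one] at h

/-- The positive part of a fixed point is proportional to every column of the adjugate. Conversely,
a column of constant sign can be normalized to a point of the simplex. -/
theorem simplexSupport_image_fixed (hV : IsVolterraOpOf A V) (hA : IsTransversalMatrix A) :
    simplexSupport '' {x | V x = x} = {β | IsFixSupport A β} := by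
  have hskew := hV.1.1
  ext β
  constructor
  · rintro ⟨x, hx, rfl⟩
    have hodd := odd_card_simplexSupport hV hA hx
    refine ⟨hodd, ?_⟩
    set β := simplexSupport x with hβ
    intro i i' j
    have hodd' : Odd (Fintype.card β) := by rwa [Fintype.card_coe]
    set w := (A.principal β).adjugate
    have hpos : ∀ i : β, 0 < x i := fun i =>
      lt_of_le_of_ne (stdSimplex.zero_le x i) (Ne.symm (mem_simplexSupport.1 i.2))
    have hw := (hA.restrict β).adjugate_ne_zero (fun k i => hskew k i) hodd' i j
    have h := (hA.restrict β).mul_eq_mul_of_mulVec_eq_zero hodd' (hV.mulVec_principal hx rfl)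
      (Matrix.mulVec_adjugate_col_of_skew (M := A.principal β) (fun k i => hskew k i) hodd' j) i i'
    have h1 : w i j * w i' j * x i = w i j ^ 2 * x i' := by
      change x i * w i' j = w i j * x i' at h
      linear_combination w i j * h
    have h2 : 0 < w i j ^ 2 * x i' := mul_pos (by positivity) (hpos i')
    rw [← h1] at h2
    exact pos_of_mul_pos_left h2 (hpos i).le
  · rintro ⟨hodd, hpos⟩
    have hodd' : Odd (Fintype.card β) := by rwa [Fintype.card_coe]
    obtain ⟨j⟩ : Nonempty β := Fintype.card_pos_iff.1 hodd'.pos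
    set w := (A.principal β).adjugate with hw
    -- The factor `w j j` makes all entries of column `j` positive, whatever their common sign.
    set s := ∑ i, w j j * w i j with hs
    have hs0 : 0 < s := Finset.sum_pos (fun i _ => hpos j i j) ⟨j, Finset.mem_univ j⟩
    let y : stdSimplex ℝ β := ⟨fun i => w j j * w i j / s,
      fun i => (div_pos (hpos j i j) hs0).le, by rw [← Finset.sum_div, ← hs, div_self hs0.ne']⟩
    have hy : ∀ i, y i = w j j * w i j / s := fun i => rfl
    have hker := Matrix.mulVec_adjugate_col_of_skew (M := A.principal β)
      (fun k i => hskew k i) hodd' j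
    refine ⟨faceIncl β y, (hV.isFixed_iff _).2 fun k => ?_, ?_⟩
    · by_cases hk : k ∈ β
      · refine mul_eq_zero_of_right _ ?_
        rw [← Finset.sum_subset (Finset.subset_univ β)
          (fun i _ hi => by rw [faceIncl_apply_notMem β y hi, mul_zero]), ← Finset.sum_coe_sort]
        have h := congrFun hker ⟨k, hk⟩
        simp only [Matrix.mulVec, dotProduct, Matrix.submatrix_apply, Pi.zero_apply] at h
        have h2 : ∀ i : β, A k i * faceIncl β y i = w j j / s * (A k i * w i j) := by
          intro i
          rw [faceIncl_apply_mem, hy]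
          ring
        rw [Finset.sum_congr rfl fun i _ => h2 i, ← Finset.mul_sum, hw, h, mul_zero]
      · rw [faceIncl_apply_notMem β y hk, zero_mul]
    · ext k
      rw [mem_simplexSupport]
      by_cases hk : k ∈ β
      · refine iff_of_true ?_ hk
        rw [faceIncl_apply_mem β y ⟨k, hk⟩, hy]
        exact (div_pos (hpos j _ j) hs0).ne'
      · exact iff_of_false (fun h => h (faceIncl_apply_notMem β y hk)) hk

theorem encard_fixed_eq (hV : IsVolterraOpOf A V) (hA : IsTransversalMatrix A) :
    {x | V x = x}.encard = {β | IsFixSupport A β}.encard := by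
  rw [← simplexSupport_image_fixed hV hA, (simplexSupport_injOn hV hA).encard_image]

end FixedPoints

/-! ### Operators, matrices and finiteness -/

section Matrices

variable {ι : Type*} [Fintype ι] [DecidableEq ι]

/-- The midpoint of the edge of the simplex between two vertices. -/
noncomputable def edgeMidpoint (k i : ι) : stdSimplex ℝ ι :=
  ⟨fun j => ((if j = k then 1 else 0) + (if j = i then 1 else 0)) / 2,
    fun j => by positivity, by
      rw [← Finset.sum_div, Finset.sum_add_distrib]
      norm_num⟩

theorem edgeMidpoint_apply (k i j : ι) :
    edgeMidpoint k i j = ((if j = k then 1 else 0) + (if j = i then 1 else 0)) / 2 := rfl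

/-- The matrix of a transversal Volterra operator, read off from the midpoints of the edges. -/
noncomputable def TVOp.toMatrix (V : TVOp ι) : Matrix ι ι ℝ :=
  fun k i => if k = i then 0 else 4 * V.1 (edgeMidpoint k i) k - 2

/-- At the midpoint of the edge from `k` to `i`, the `k`-th coordinate of the image is `(1 + A k i /
2) / 2`. -/
theorem TVOp.toMatrix_eq {V : TVOp ι} {A : Matrix ι ι ℝ} (hA : IsVolterraOpOf A V.1) :
    V.toMatrix = A := by
  ext k i
  have hkk : A k k = 0 := by linarith [hA.1.1 k k]
  unfold TVOp.toMatrix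
  split_ifs with h
  · rw [← h, hkk]
  · have hsum : ∑ j, A k j * edgeMidpoint k i j = A k i / 2 := by
      simp only [edgeMidpoint_apply, mul_div_assoc', mul_add, mul_ite, mul_one, mul_zero]
      rw [← Finset.sum_div, Finset.sum_add_distrib]
      simp [hkk]
    rw [hA.2, hsum, edgeMidpoint_apply, if_pos rfl, if_neg h]
    ring

theorem TVOp.isVolterraOpOf_toMatrix (V : TVOp ι) :
    IsVolterraOpOf V.toMatrix V.1 ∧ IsTransversalMatrix V.toMatrix := by
  obtain ⟨A, hA, hT⟩ := V.2
  rw [TVOp.toMatrix_eq hA]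
  exact ⟨hA, hT⟩

theorem TVOp.continuous_toMatrix : Continuous (TVOp.toMatrix : TVOp ι → Matrix ι ι ℝ) := by
  refine continuous_pi fun k => continuous_pi fun i => ?_
  unfold TVOp.toMatrix
  split_ifs with h
  · exact continuous_const
  · have h1 : Continuous fun V : TVOp ι => V.1 (edgeMidpoint k i) :=
      (continuous_eval_const _).comp continuous_subtype_val
    exact (continuous_const.mul ((continuous_apply k).comp
      (continuous_subtype_val.comp h1))).sub continuous_const

theorem TVOp.fixCard_eq_encard (V : TVOp ι) :
    V.fixCard = {β | IsFixSupport V.toMatrix β}.encard :=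
  encard_fixed_eq V.isVolterraOpOf_toMatrix.1 V.isVolterraOpOf_toMatrix.2

/-- A continuous real function without zeros has constant sign on a path. -/
theorem Joined.pos_of_pos {X : Type*} [TopologicalSpace X] {x y : X} (h : Joined x y) {f : X → ℝ}
    (hf : Continuous f) (h0 : ∀ z, f z ≠ 0) (hx : 0 < f x) : 0 < f y := by
  obtain ⟨γ⟩ := h
  by_contra hy
  obtain ⟨z, -, hz⟩ := (isPreconnected_range γ.continuous).intermediate_value ⟨1, γ.target⟩
    ⟨0, γ.source⟩ hf.continuousOn ⟨not_lt.1 hy, hx.le⟩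
  exact h0 z hz

/-- The products of adjugate entries are continuous and never zero on transversal operators, so
their signs persist along paths. -/
theorem TVOp.isFixSupport_of_joined {V W : TVOp ι} (h : Joined V W) {β : Finset ι}
    (hβ : IsFixSupport V.toMatrix β) : IsFixSupport W.toMatrix β := by
  refine ⟨hβ.1, fun i i' j => ?_⟩
  have hc : Continuous fun V : TVOp ι => (V.toMatrix.principal β).adjugate :=
    (TVOp.continuous_toMatrix.matrix_submatrix _ _).matrix_adjugate
  have hn : ∀ (V : TVOp ι) i j, (V.toMatrix.principal β).adjugate i j ≠ 0 := fun V =>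
    (V.isVolterraOpOf_toMatrix.2.restrict β).adjugate_ne_zero
      (fun k i => V.isVolterraOpOf_toMatrix.1.1.1 k i) (by rw [Fintype.card_coe]; exact hβ.1)
  exact h.pos_of_pos (f := fun V : TVOp ι => (V.toMatrix.principal β).adjugate i j *
    (V.toMatrix.principal β).adjugate i' j) ((hc.matrix_elem i j).mul (hc.matrix_elem i' j))
    (fun V => mul_ne_zero (hn V i j) (hn V i' j)) (hβ.2 i i' j)

/-- The number of fixed points does not change along paths of transversal operators. -/
theorem TVOp.fixCard_eq_of_joined {V W : TVOp ι} (h : Joined V W) : V.fixCard = W.fixCard := by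
  rw [V.fixCard_eq_encard, W.fixCard_eq_encard]
  congr 1
  ext β
  exact ⟨TVOp.isFixSupport_of_joined h, TVOp.isFixSupport_of_joined h.symm⟩

theorem TVOp.homotopic_iff_joined {V W : TVOp ι} : V.Homotopic W ↔ Joined V W := by
  refine ⟨fun ⟨γ, _⟩ => ⟨γ⟩, fun ⟨γ⟩ => ⟨γ, fun t => ⟨?_, ?_⟩⟩⟩
  · exact TVOp.fixCard_eq_of_joined ⟨(γ.subpath t 0).cast rfl γ.source.symm⟩
  · exact TVOp.fixCard_eq_of_joined ⟨(γ.subpath t 1).cast rfl γ.target.symm⟩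

theorem TVOp.continuous_restrict (α : Finset ι) :
    Continuous fun V : TVOp ι => V.restrict α := by
  refine Continuous.subtype_mk (ContinuousMap.continuous_of_continuous_uncurry _ ?_) _
  refine Continuous.subtype_mk (continuous_pi fun k => ?_) _
  have h1 : Continuous fun p : TVOp ι × stdSimplex ℝ α => p.1.1 (faceIncl α p.2) :=
    (continuous_subtype_val.comp continuous_fst).eval ((continuous_faceIncl α).comp continuous_snd)
  exact (continuous_apply (k : ι)).comp (continuous_subtype_val.comp h1)

/-- The Volterra operator of a matrix. -/
def volterraMap (A : Matrix ι ι ℝ) (hA : IsVolterraMatrix A) :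
    C(stdSimplex ℝ ι, stdSimplex ℝ ι) where
  toFun x := ⟨fun k => x k * (1 + ∑ i, A k i * x i), fun k => by
      refine mul_nonneg (stdSimplex.zero_le x k) ?_
      have h : ∑ i, -x i ≤ ∑ i, A k i * x i := Finset.sum_le_sum fun i _ => by
        nlinarith [neg_le_of_abs_le (hA.2 k i), stdSimplex.zero_le x i]
      rw [Finset.sum_neg_distrib, stdSimplex.sum_eq_one] at h
      linarith, by
      -- The quadratic form of a skew-symmetric matrix vanishes, so the coordinate sum is preserved.
      have h : ∑ k, ∑ i, x k * (A k i * x i) = -∑ k, ∑ i, x k * (A k i * x i) := by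
        conv_lhs => rw [Finset.sum_comm]
        simp_rw [← Finset.sum_neg_distrib]
        refine Finset.sum_congr rfl fun k _ => Finset.sum_congr rfl fun i _ => ?_
        rw [hA.1 i k]
        ring
      simp only [mul_add, mul_one, Finset.sum_add_distrib, Finset.mul_sum]
      rw [stdSimplex.sum_eq_one]
      linarith⟩
  continuous_toFun := by
    refine Continuous.subtype_mk (continuous_pi fun k => ?_) _
    have h : ∀ i, Continuous fun x : stdSimplex ℝ ι => x i := fun i =>
      (continuous_apply i).comp continuous_subtype_val
    exact (h k).mul (continuous_const.add
      (continuous_finsetSum _ fun i _ => continuous_const.mul (h i)))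

omit [DecidableEq ι] in
theorem isVolterraOpOf_volterraMap {A : Matrix ι ι ℝ} (hA : IsVolterraMatrix A) :
    IsVolterraOpOf A (volterraMap A hA) :=
  ⟨hA, fun _ _ => rfl⟩

/-- The transversal Volterra operator of a matrix. -/
def TVOp.ofMatrix (A : {A : Matrix ι ι ℝ // IsVolterraMatrix A ∧ IsTransversalMatrix A}) : TVOp ι :=
  ⟨volterraMap A.1 A.2.1, A.1, isVolterraOpOf_volterraMap A.2.1, A.2.2⟩

theorem TVOp.continuous_ofMatrix : Continuous (TVOp.ofMatrix (ι := ι)) := by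
  refine Continuous.subtype_mk (ContinuousMap.continuous_of_continuous_uncurry _ ?_) _
  refine Continuous.subtype_mk (continuous_pi fun k => ?_) _
  have h : ∀ i, Continuous fun p : {A : Matrix ι ι ℝ // IsVolterraMatrix A ∧
      IsTransversalMatrix A} × stdSimplex ℝ ι => p.2 i := fun i =>
    (continuous_apply i).comp (continuous_subtype_val.comp continuous_snd)
  have h' : ∀ i, Continuous fun p : {A : Matrix ι ι ℝ // IsVolterraMatrix A ∧
      IsTransversalMatrix A} × stdSimplex ℝ ι => p.1.1 k i := fun i =>
    (continuous_subtype_val.comp continuous_fst).matrix_elem k i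
  exact (h k).mul (continuous_const.add (continuous_finsetSum _ fun i _ => (h' i).mul (h i)))

theorem TVOp.ofMatrix_toMatrix (V : TVOp ι) :
    TVOp.ofMatrix ⟨V.toMatrix, V.isVolterraOpOf_toMatrix.1.1, V.isVolterraOpOf_toMatrix.2⟩ = V := by
  refine Subtype.ext (ContinuousMap.ext fun x => Subtype.ext (funext fun k => ?_))
  exact (V.isVolterraOpOf_toMatrix.1.2 x k).symm

/-- The skew-symmetric matrix with entries of size at most one made of an arbitrary matrix. -/
noncomputable def skewNormalize (B : ι × ι → ℝ) : Matrix ι ι ℝ :=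
  (max 1 (2 * ‖B‖))⁻¹ • Matrix.of fun k i => B (k, i) - B (i, k)

omit [DecidableEq ι] in
theorem isVolterraMatrix_skewNormalize (B : ι × ι → ℝ) : IsVolterraMatrix (skewNormalize B) := by
  have hpos : 0 < max 1 (2 * ‖B‖) := lt_max_of_lt_left one_pos
  refine ⟨fun k i => ?_, fun k i => ?_⟩
  · simp only [skewNormalize, Matrix.smul_apply, Matrix.of_apply, smul_eq_mul]
    ring
  · simp only [skewNormalize, Matrix.smul_apply, Matrix.of_apply, smul_eq_mul]
    rw [abs_mul, abs_inv, abs_of_pos hpos, inv_mul_le_iff₀ hpos, mul_one]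
    refine le_max_of_le_right ((abs_sub _ _).trans ?_)
    have h1 := norm_le_pi_norm B (k, i)
    have h2 := norm_le_pi_norm B (i, k)
    rw [Real.norm_eq_abs] at h1 h2
    linarith

omit [DecidableEq ι] in
theorem continuous_skewNormalize : Continuous (skewNormalize : (ι × ι → ℝ) → Matrix ι ι ℝ) := by
  refine Continuous.smul (Continuous.inv₀
    (continuous_const.max (continuous_const.mul continuous_norm)) fun B =>
    (lt_max_of_lt_left one_pos).ne') ?_
  exact continuous_matrix fun k i => (continuous_apply _).sub (continuous_apply _)

open MvPolynomial in
/-- The product of the principal minors of even order of the skew-symmetric matrix made of a matrix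
of indeterminates. -/
noncomputable def evenMinorProduct (ι : Type*) [Fintype ι] [DecidableEq ι] :
    MvPolynomial (ι × ι) ℝ :=
  ∏ β : Finset ι with Even β.card,
    (Matrix.principal (Matrix.of fun k i => X (k, i) - X (i, k)) β).det

/-- The positive scaling multiplies each minor by a nonzero power and does not affect vanishing. -/
theorem eval_evenMinorProduct_ne_zero_iff (B : ι × ι → ℝ) :
    MvPolynomial.eval B (evenMinorProduct ι) ≠ 0 ↔ IsTransversalMatrix (skewNormalize B) := by
  have hpos : 0 < max 1 (2 * ‖B‖) := lt_max_of_lt_left one_pos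
  rw [evenMinorProduct, map_prod, Finset.prod_ne_zero_iff]
  simp only [Finset.mem_filter, Finset.mem_univ, true_and]
  refine forall_congr' fun β => imp_congr_right fun _ => not_congr ?_
  have h : (MvPolynomial.eval B) (Matrix.principal (Matrix.of fun k i =>
      MvPolynomial.X (R := ℝ) (k, i) - MvPolynomial.X (i, k)) β).det =
      (Matrix.principal (Matrix.of fun k i => B (k, i) - B (i, k)) β).det := by
    rw [RingHom.map_det]
    congr 1
    ext k i
    simp
  have h' : (skewNormalize B).principal β = (max 1 (2 * ‖B‖))⁻¹ •
      Matrix.principal (Matrix.of fun k i => B (k, i) - B (i, k)) β := rfl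
  change _ = 0 ↔ ((skewNormalize B).principal β).det = 0
  rw [h, h', Matrix.det_smul, mul_eq_zero]
  exact (or_iff_right (pow_ne_zero _ (inv_ne_zero hpos.ne'))).symm

/-- The space of transversal Volterra operators has finitely many path components. -/
theorem TVOp.hasFinitelyManyPathComponents :
    HasFinitelyManyPathComponents (Set.univ : Set (TVOp ι)) := by
  have hU := (evenMinorProduct ι).hasFinitelyManyPathComponents_of_finite.univ_subtype
  refine hU.image (f := fun B => TVOp.ofMatrix ⟨skewNormalize B.1,
    isVolterraMatrix_skewNormalize _, (eval_evenMinorProduct_ne_zero_iff _).1 B.2⟩) ?_ ?_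
  · refine (TVOp.continuous_ofMatrix.comp (Continuous.subtype_mk ?_ _)).continuousOn
    exact continuous_skewNormalize.comp continuous_subtype_val
  · rw [Set.image_univ, Set.range_eq_univ]
    intro V
    obtain ⟨⟨hskew, hbd⟩, -⟩ := V.isVolterraOpOf_toMatrix.1
    -- Halving makes the norm at most `1 / 2`, so the normalizing factor is `1`, and skew-symmetry
    -- restores the matrix.
    have hB : skewNormalize (fun p : ι × ι => V.toMatrix p.1 p.2 / 2) = V.toMatrix := by
      have hn : ‖fun p : ι × ι => V.toMatrix p.1 p.2 / 2‖ ≤ 1 / 2 := by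
        refine (pi_norm_le_iff_of_nonneg (by norm_num)).2 fun p => ?_
        rw [Real.norm_eq_abs, abs_div, abs_two]
        linarith [hbd p.1 p.2]
      ext k i
      rw [skewNormalize, max_eq_left (by linarith), inv_one, one_smul, Matrix.of_apply]
      change V.toMatrix k i / 2 - V.toMatrix i k / 2 = V.toMatrix k i
      linarith [hskew k i]
    refine ⟨⟨fun p => V.toMatrix p.1 p.2 / 2, (eval_evenMinorProduct_ne_zero_iff _).2 ?_⟩, ?_⟩
    · rw [hB]
      exact V.isVolterraOpOf_toMatrix.2
    · conv_rhs => rw [← V.ofMatrix_toMatrix]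
      exact congrArg _ (Subtype.ext hB)

end Matrices

/-! ### Homotopy classes as path components -/

section Classes

variable {ι : Type*} [Fintype ι] [DecidableEq ι]

theorem TVOp.mem_homotopyClasses_iff {C : Set (TVOp ι)} :
    C ∈ TVOp.homotopyClasses ι ↔ ∃ V, C = pathComponent V := by
  refine exists_congr fun V => ?_
  have : {W | (TVOp.homotopySetoid ι) W V} = pathComponent V := by
    ext W
    exact TVOp.homotopic_iff_joined.trans ⟨Joined.symm, Joined.symm⟩
  rw [this]

theorem TVOp.finite_homotopyClasses : (TVOp.homotopyClasses ι).Finite := by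
  obtain ⟨S, hS, h⟩ := TVOp.hasFinitelyManyPathComponents (ι := ι)
  refine (hS.image pathComponent).subset fun C hC => ?_
  obtain ⟨V, rfl⟩ := TVOp.mem_homotopyClasses_iff.1 hC
  obtain ⟨s, hs, hj⟩ := h V (Set.mem_univ V)
  exact ⟨s, hs, (pathComponent_congr hj.joined).symm⟩

theorem TVOp.isPathConnected_of_mem_homotopyClasses {C : Set (TVOp ι)}
    (hC : C ∈ TVOp.homotopyClasses ι) : IsPathConnected C := by
  obtain ⟨V, rfl⟩ := TVOp.mem_homotopyClasses_iff.1 hC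
  exact isPathConnected_pathComponent

/-- Restricting a path to the face gives a path of transversal operators there, hence a homotopy. -/
theorem mem_homotopicExtensions_of_joined {α : Finset ι} {V₀ : TVOp α} {V W : TVOp ι}
    (hV : V ∈ homotopicExtensions α V₀) (h : Joined V W) : W ∈ homotopicExtensions α V₀ :=
  TVOp.homotopic_iff_joined.2
    ((h.map (TVOp.continuous_restrict α)).symm.trans (TVOp.homotopic_iff_joined.1 hV))

/-- A homotopy class is contained in the set of homotopic extensions as soon as it meets it. -/
theorem homotopicExtensions_inter_eq {α : Finset ι} {V₀ : TVOp α} {C : Set (TVOp ι)}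
    (hC : C ∈ TVOp.homotopyClasses ι) (hne : (homotopicExtensions α V₀ ∩ C).Nonempty) :
    homotopicExtensions α V₀ ∩ C = C := by
  obtain ⟨V, rfl⟩ := TVOp.mem_homotopyClasses_iff.1 hC
  obtain ⟨W, hW, hVW⟩ := hne
  exact Set.inter_eq_right.2 fun U hU =>
    mem_homotopicExtensions_of_joined hW (Joined.trans (Joined.symm hVW) hU)

theorem pathComponentIn_homotopicExtensions {α : Finset ι} {V₀ : TVOp α} {V : TVOp ι}
    (hV : V ∈ homotopicExtensions α V₀) :
    pathComponentIn (homotopicExtensions α V₀) V = pathComponent V := by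
  refine Set.Subset.antisymm (fun W hW => JoinedIn.joined hW) ?_
  have h := homotopicExtensions_inter_eq (TVOp.mem_homotopyClasses_iff.2 ⟨V, rfl⟩)
    ⟨V, hV, mem_pathComponent_self V⟩
  exact isPathConnected_pathComponent.subset_pathComponentIn (mem_pathComponent_self V)
    (Set.inter_eq_right.1 h)

theorem pathComponentsOf_homotopicExtensions (α : Finset ι) (V₀ : TVOp α) :
    pathComponentsOf (homotopicExtensions α V₀) =
      {C | C.Nonempty ∧
        ∃ 𝒱 ∈ TVOp.homotopyClasses ι, C = homotopicExtensions α V₀ ∩ 𝒱} := by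
  ext C
  constructor
  · rintro ⟨V, hV, rfl⟩
    have hC := TVOp.mem_homotopyClasses_iff.2 ⟨V, rfl⟩
    rw [pathComponentIn_homotopicExtensions hV]
    exact ⟨pathComponent.nonempty V, _, hC,
      (homotopicExtensions_inter_eq hC ⟨V, hV, mem_pathComponent_self V⟩).symm⟩
  · rintro ⟨⟨V, hVC⟩, 𝒱, h𝒱, rfl⟩
    refine ⟨V, hVC.1, ?_⟩
    rw [pathComponentIn_homotopicExtensions hVC.1, homotopicExtensions_inter_eq h𝒱 ⟨V, hVC⟩]
    obtain ⟨W, rfl⟩ := TVOp.mem_homotopyClasses_iff.1 h𝒱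
    exact (pathComponent_congr hVC.2).symm

end Classes

theorem mainTheorem12 (m : ℕ) (α : Finset (Fin m)) (V₀ : TVOp α) :
    (∀ 𝒱 ∈ TVOp.homotopyClasses (Fin m), (homotopicExtensions α V₀ ∩ 𝒱).Nonempty →
      IsPathConnected (homotopicExtensions α V₀ ∩ 𝒱)) ∧
    homotopicExtensions α V₀ =
      ⋃ 𝒱 ∈ TVOp.homotopyClasses (Fin m), homotopicExtensions α V₀ ∩ 𝒱 ∧
    pathComponentsOf (homotopicExtensions α V₀) =
      {C | C.Nonempty ∧
        ∃ 𝒱 ∈ TVOp.homotopyClasses (Fin m), C = homotopicExtensions α V₀ ∩ 𝒱} ∧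
    (TVOp.homotopyClasses (Fin m)).Finite ∧
    (pathComponentsOf (homotopicExtensions α V₀)).ncard ≤
      (TVOp.homotopyClasses (Fin m)).ncard := by
  refine ⟨fun 𝒱 h𝒱 hne => ?_, ?_, pathComponentsOf_homotopicExtensions α V₀,
    TVOp.finite_homotopyClasses, Set.ncard_le_ncard ?_ TVOp.finite_homotopyClasses⟩
  · rw [homotopicExtensions_inter_eq h𝒱 hne]
    exact TVOp.isPathConnected_of_mem_homotopyClasses h𝒱
  · rw [← Set.inter_iUnion₂]
    refine (Set.inter_eq_left.2 fun V _ => ?_).symm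
    exact Set.mem_biUnion (TVOp.mem_homotopyClasses_iff.2 ⟨V, rfl⟩) (mem_pathComponent_self V)
  · rw [pathComponentsOf_homotopicExtensions]
    rintro _ ⟨hne, 𝒱, h𝒱, rfl⟩
    rwa [homotopicExtensions_inter_eq h𝒱 hne]
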